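/- Let $V,U$ be real Banach spaces, $T\ge 0$, $p\ge 1$, $n=\lfloor p\rfloor$. Let $X:[0,T]\to V$ have finite $p$-variation, i.e. $\sup_\Pi\sum_{[u,v]\in\Pi}\|X_v-X_u\|^p<\infty$ over all partitions $\Pi$ of $[0,T]$, and let $F:V\to U$ be $n+1$ times continuously differentiable with $D^jF$ bounded for $j=0,\dots,n+1$. Write $X_{t-}=\lim_{u\uparrow t}X_u$, $X_{t+}=\lim_{u\downarrow t}X_u$, $\Delta_t^-X=X_t-X_{t-}$, $\Delta_t^+X=X_{t+}-X_t$. A Riemann sum $\sum_{[u,v]\in\Pi}\Xi_{u,v}$ converges to $K$ in the refinement Riemann–Stieltjes (RRS) sense if for every $\varepsilon>0$ there is a partition $\Pi_\varepsilon$ of $[0,T]$ such that $\|\sum_{[u,v]\in\Pi}\Xi_{u,v}-K\|<\varepsilon$ for every partition $\Pi$ of $[0,T]$ that refines $\Pi_\varepsilon$. 1. The limits $X_{t-}$ ($0<t\le T$) and $X_{t+}$ ($0\le t<T$) exist, the reduced rough integral $$\int_0^T DF(X_t)\,dX_t:=\mathrm{RRS}\text{-}\lim_{\Pi}\sum_{[u,v]\in\Pi}\sum_{k=1}^{n}\frac1{k!}D^kF(X_u)(X_v-X_u)^{\otimes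 k}$$ exists and is unique, the two series below converge absolutely, and $$\begin{aligned}F(X_T)-F(X_0)={}&\int_0^T DF(X_t)\,dX_t+\sum_{0<t\le T}\Big(F(X_t)-F(X_{t-})-\sum_{k=1}^{n}\frac1{k!}D^kF(X_{t-})(\Delta_t^-X)^{\otimes k}\Big)\\&+\sum_{0\le t<T}\Big(F(X_{t+})-F(X_t)-\sum_{k=1}^{n}\frac1{k!}D^kF(X_t)(\Delta_t^+X)^{\otimes k}\Big).\end{aligned}$$ 2. If $X$ is right-continuous on $[0,T)$ (in particular if $X$ is càdlàg), then $$F(X_T)-F(X_0)=\int_0^T DF(X_t)\,dX_t+\sum_{0<t\le T}\Big(F(X_t)-F(X_{t-})-\sum_{k=1}^{n}\frac1{k!}D^kF(X_{t-})(\Delta_t^-X)^{\otimes k}\Big).$$ 3. If $X$ is continuous on $[0,T]$, then $F(X_T)-F(X_0)=\int_0^T DF(X_t)\,dX_t$. -/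

import Mathlib

open Filter Topology
open scoped ENNReal

/-- `P` is (the set of points of) a partition `0 = t₀ < t₁ < ⋯ < t_N = T` of `[0, T]`.
A partition `Q` refines `P` when `P ⊆ Q`. -/
def IsPartition (T : ℝ) (P : Finset ℝ) : Prop :=
  0 ∈ P ∧ T ∈ P ∧ ∀ t ∈ P, 0 ≤ t ∧ t ≤ T

/-- The intervals `[u, v]` of a partition: pairs of consecutive points of `P`. -/
noncomputable def partitionIntervals (P : Finset ℝ) : Finset (ℝ × ℝ) :=
  (P ×ˢ P).filter fun q => q.1 < q.2 ∧ ∀ w ∈ P, ¬ (q.1 < w ∧ w < q.2)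

/-- The Riemann sum `∑_{[u,v] ∈ P} Ξ_{u,v}`. -/
noncomputable def partitionSum {E : Type*} [AddCommMonoid E] (Ξ : ℝ → ℝ → E)
    (P : Finset ℝ) : E :=
  ∑ q ∈ partitionIntervals P, Ξ q.1 q.2

/-- The `p`-variation of the path `X` on `[0, T]`, as an extended nonnegative real. Only the values
of `X` on `[0, T]` matter. -/
noncomputable def pVariation {V : Type*} [NormedAddCommGroup V] (p T : ℝ) (X : ℝ → V) : ℝ≥0∞ :=
  (⨆ (P : Finset ℝ) (_ : IsPartition T P),
    partitionSum (fun u v => ‖X v - X u‖ₑ ^ p) P) ^ (1 / p)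

/-- `K` is the limit of the Riemann sums of `Ξ` over the partitions of `[0, T]` in the refinement
Riemann–Stieltjes sense. -/
def IsRRSLimit {E : Type*} [NormedAddCommGroup E] (T : ℝ) (Ξ : ℝ → ℝ → E) (K : E) : Prop :=
  ∀ ε > 0, ∃ P₀ : Finset ℝ, IsPartition T P₀ ∧
    ∀ P : Finset ℝ, IsPartition T P → P₀ ⊆ P → ‖partitionSum Ξ P - K‖ < ε

open Classical in
/-- The refinement Riemann–Stieltjes limit of the Riemann sums of `Ξ`, when it exists
(and `0` otherwise). -/
noncomputable def rrsLimit {E : Type*} [NormedAddCommGroup E] (T : ℝ) (Ξ : ℝ → ℝ → E) : E :=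
  if h : ∃ K, IsRRSLimit T Ξ K then h.choose else 0

/-- `F ∈ C_b^m(V, U)`: `F` is `m` times continuously differentiable, and its differentials of
orders `0, …, m` are bounded. -/
def IsCb {V U : Type*} [NormedAddCommGroup V] [NormedSpace ℝ V]
    [NormedAddCommGroup U] [NormedSpace ℝ U] (m : ℕ) (F : V → U) : Prop :=
  ContDiff ℝ m F ∧ ∀ j ≤ m, ∃ C : ℝ, ∀ x, ‖iteratedFDeriv ℝ j F x‖ ≤ C

/-- The Taylor terms `∑_{k=1}^n (1/k!) DᵏF(x) (h^{⊗k})`. -/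
noncomputable def taylorTerms {V U : Type*} [NormedAddCommGroup V] [NormedSpace ℝ V]
    [NormedAddCommGroup U] [NormedSpace ℝ U] (n : ℕ) (F : V → U) (x h : V) : U :=
  ∑ k ∈ Finset.Icc 1 n, (1 / (k.factorial : ℝ)) • iteratedFDeriv ℝ k F x (fun _ => h)

/-- The summand `∑_{k=1}^n (1/k!) DᵏF(X_u) (X_v - X_u)^{⊗k}` attached to an interval `[u, v]`. -/
noncomputable def roughSummand {V U : Type*} [NormedAddCommGroup V] [NormedSpace ℝ V]
    [NormedAddCommGroup U] [NormedSpace ℝ U] (n : ℕ) (F : V → U) (X : ℝ → V) (u v : ℝ) : U :=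
  taylorTerms n F (X u) (X v - X u)

/-- The reduced rough integral `∫₀ᵀ DF(X_t) d𝕏_t` of a path of finite `p`-variation. -/
noncomputable def reducedRoughIntegral {V U : Type*} [NormedAddCommGroup V] [NormedSpace ℝ V]
    [NormedAddCommGroup U] [NormedSpace ℝ U] (p T : ℝ) (F : V → U) (X : ℝ → V) : U :=
  rrsLimit T (roughSummand ⌊p⌋₊ F X)

/-- The left-jump correction at `t`, with `X_{t-}` written `Function.leftLim X t`. -/
noncomputable def leftJumpCorrection {V U : Type*} [NormedAddCommGroup V] [NormedSpace ℝ V]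
    [NormedAddCommGroup U] [NormedSpace ℝ U] (n : ℕ) (F : V → U) (X : ℝ → V) (t : ℝ) : U :=
  F (X t) - F (Function.leftLim X t)
    - taylorTerms n F (Function.leftLim X t) (X t - Function.leftLim X t)

/-- The right-jump correction at `t`, with `X_{t+}` written `Function.rightLim X t`. -/
noncomputable def rightJumpCorrection {V U : Type*} [NormedAddCommGroup V] [NormedSpace ℝ V]
    [NormedAddCommGroup U] [NormedSpace ℝ U] (n : ℕ) (F : V → U) (X : ℝ → V) (t : ℝ) : U :=
  F (Function.rightLim X t) - F (X t)
    - taylorTerms n F (X t) (Function.rightLim X t - X t)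

/-! ### Partitions -/

/-! Write `R(x, y)` for the Taylor remainder of order `n`. Since `F (X T) - F (X 0)` telescopes over
any partition, the Riemann sum of `roughSummand` is this increment minus the sum of `R(X u, X v)`.
The formula therefore says that the remainder sums converge to the two jump series, whose terms are
`R(X_{t-}, X_t)` and `R(X_t, X_{t+})`.

Finite `p`-variation gives a monotone `w` with `‖X v - X u‖ ^ p ≤ w v - w u`, and bounded `D^{n+1}F`
gives `‖R(X u, X v)‖ ≤ C (w v - w u) ^ θ` with `θ = (n + 1) / p > 1`. Jump corrections inherit the
bound in the limit, so both series converge absolutely and are themselves RRS limits of one-endpoint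
sums (`isRRSLimit_left`, `isRRSLimit_right`).

After subtracting both corrections, the remainder still obeys the superlinear bound and now vanishes
as either endpoint approaches the other. Such sums tend to zero (`isRRSLimit_zero_of_control`):
finitely many points carry the large oscillations of `w`, intervals touching them are made
negligible by refinement, and the others contribute at most a small multiple of `w T - w 0`. -/

theorem mem_partitionIntervals {P : Finset ℝ} {q : ℝ × ℝ} :
    q ∈ partitionIntervals P ↔
      (q.1 ∈ P ∧ q.2 ∈ P) ∧ q.1 < q.2 ∧ ∀ w ∈ P, ¬ (q.1 < w ∧ w < q.2) := by
  simp [partitionIntervals]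

theorem IsPartition.insert_right {u v : ℝ} {P : Finset ℝ} (hP : IsPartition u P) (huv : u ≤ v) :
    IsPartition v (insert v P) := by
  have h0u := (hP.2.2 u hP.2.1).1
  refine ⟨Finset.mem_insert_of_mem hP.1, Finset.mem_insert_self _ _, fun t ht => ?_⟩
  rcases Finset.mem_insert.1 ht with rfl | ht
  · exact ⟨h0u.trans huv, le_rfl⟩
  · exact ⟨(hP.2.2 t ht).1, (hP.2.2 t ht).2.trans huv⟩

theorem IsPartition.union {T : ℝ} {P Q : Finset ℝ} (hP : IsPartition T P) (hQ : IsPartition T Q) :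
    IsPartition T (P ∪ Q) :=
  ⟨Finset.mem_union_left _ hP.1, Finset.mem_union_left _ hP.2.1, fun t ht =>
    (Finset.mem_union.1 ht).elim (hP.2.2 t) (hQ.2.2 t)⟩

/-- The partition of `[0, T]` by the points of a finite subset of `[0, T]`. -/
theorem isPartition_insert_insert {T : ℝ} (hT : 0 ≤ T) {A : Finset ℝ}
    (hA : ∀ a ∈ A, a ∈ Set.Icc 0 T) : IsPartition T (insert 0 (insert T A)) := by
  refine ⟨by simp, by simp, fun t ht => ?_⟩
  simp only [Finset.mem_insert] at ht
  rcases ht with rfl | rfl | ht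
  · exact ⟨le_rfl, hT⟩
  · exact ⟨hT, le_rfl⟩
  · exact hA t ht

/-- Induction on partitions, adding one interval on the right at a time. -/
theorem isPartition_induction {C : ℝ → Finset ℝ → Prop} (zero : C 0 {0})
    (step : ∀ u v P, IsPartition u P → u < v → C u P → C v (insert v P))
    {T : ℝ} {P : Finset ℝ} (hP : IsPartition T P) : C T P := by
  induction hn : P.card using Nat.strong_induction_on generalizing T P with
  | _ n ih =>
    subst hn
    by_cases hT : T = 0
    · subst hT
      have : P = {0} := by
        ext t
        simp only [Finset.mem_singleton]
        exact ⟨fun ht => le_antisymm (hP.2.2 t ht).2 (hP.2.2 t ht).1, fun ht => ht ▸ hP.1⟩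
      rwa [this]
    · have h0 : 0 ∈ P.erase T := Finset.mem_erase.2 ⟨Ne.symm hT, hP.1⟩
      have hne : (P.erase T).Nonempty := ⟨0, h0⟩
      set u := (P.erase T).max' hne with hu
      have hum : u ∈ P.erase T := Finset.max'_mem _ _
      have huP : IsPartition u (P.erase T) :=
        ⟨h0, hum, fun t ht => ⟨(hP.2.2 t (Finset.mem_of_mem_erase ht)).1, Finset.le_max' _ _ ht⟩⟩
      have huT : u < T := lt_of_le_of_ne (hP.2.2 u (Finset.mem_of_mem_erase hum)).2
        (Finset.ne_of_mem_erase hum)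
      have := step u T _ huP huT (ih _ (Finset.card_erase_lt_of_mem hP.2.1) huP rfl)
      rwa [Finset.insert_erase hP.2.1] at this

theorem partitionIntervals_insert {u v : ℝ} {P : Finset ℝ} (hP : IsPartition u P) (huv : u < v) :
    partitionIntervals (insert v P) = insert (u, v) (partitionIntervals P) := by
  have hle : ∀ t ∈ P, t ≤ u := fun t ht => (hP.2.2 t ht).2
  have hu := hP.2.1
  ext ⟨a, b⟩
  simp only [mem_partitionIntervals, Finset.mem_insert, Prod.mk.injEq]
  grind

theorem partitionSum_insert {E : Type*} [AddCommMonoid E] (Ξ : ℝ → ℝ → E) {u v : ℝ}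
    {P : Finset ℝ} (hP : IsPartition u P) (huv : u < v) :
    partitionSum Ξ (insert v P) = Ξ u v + partitionSum Ξ P := by
  rw [partitionSum, partitionIntervals_insert hP huv, Finset.sum_insert, partitionSum]
  intro h
  exact absurd (hP.2.2 v (mem_partitionIntervals.1 h).1.2).2 (not_le.2 huv)

theorem partitionSum_singleton {E : Type*} [AddCommMonoid E] (Ξ : ℝ → ℝ → E) (t : ℝ) :
    partitionSum Ξ {t} = 0 := by
  refine Finset.sum_eq_zero fun q hq => ?_
  have h := mem_partitionIntervals.1 hq
  simp only [Finset.mem_singleton] at h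
  exact absurd h.2.1 (by rw [h.1.1, h.1.2]; exact lt_irrefl _)

theorem partitionSum_telescope {E : Type*} [AddCommGroup E] (g : ℝ → E) {T : ℝ} {P : Finset ℝ}
    (hP : IsPartition T P) : partitionSum (fun u v => g v - g u) P = g T - g 0 := by
  refine isPartition_induction (hP := hP) (C := fun T P => partitionSum (fun u v => g v - g u) P = g T - g 0) ?_ ?_
  · simp [partitionSum_singleton]
  · intro u v P hP huv ih
    rw [partitionSum_insert _ hP huv, ih]
    abel

theorem partitionSum_left {E : Type*} [AddCommMonoid E] (f : ℝ → E) {T : ℝ} {P : Finset ℝ}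
    (hP : IsPartition T P) : partitionSum (fun u _ => f u) P = ∑ t ∈ P.erase T, f t := by
  refine isPartition_induction (hP := hP)
    (C := fun T P => partitionSum (fun u _ => f u) P = ∑ t ∈ P.erase T, f t) ?_ ?_
  · simp [partitionSum_singleton]
  · intro u v P hP huv ih
    have hv : v ∉ P := fun h => absurd (hP.2.2 v h).2 (not_le.2 huv)
    rw [partitionSum_insert _ hP huv, ih, Finset.erase_insert hv, Finset.add_sum_erase _ _ hP.2.1]

theorem partitionSum_right {E : Type*} [AddCommMonoid E] (f : ℝ → E) {T : ℝ} {P : Finset ℝ}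
    (hP : IsPartition T P) : partitionSum (fun _ v => f v) P = ∑ t ∈ P.erase 0, f t := by
  refine isPartition_induction (hP := hP)
    (C := fun T P => partitionSum (fun _ v => f v) P = ∑ t ∈ P.erase 0, f t) ?_ ?_
  · simp [partitionSum_singleton]
  · intro u v P hP huv ih
    have hv : v ∉ P := fun h => absurd (hP.2.2 v h).2 (not_le.2 huv)
    have hv0 : v ≠ 0 := ((hP.2.2 u hP.2.1).1.trans_lt huv).ne'
    rw [partitionSum_insert _ hP huv, ih, Finset.erase_insert_of_ne hv0,
      Finset.sum_insert (fun h => hv (Finset.mem_of_mem_erase h))]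

theorem partitionSum_add {E : Type*} [AddCommMonoid E] (Ξ Ψ : ℝ → ℝ → E) (P : Finset ℝ) :
    partitionSum (fun u v => Ξ u v + Ψ u v) P = partitionSum Ξ P + partitionSum Ψ P :=
  Finset.sum_add_distrib

theorem partitionSum_sub {E : Type*} [AddCommGroup E] (Ξ Ψ : ℝ → ℝ → E) (P : Finset ℝ) :
    partitionSum (fun u v => Ξ u v - Ψ u v) P = partitionSum Ξ P - partitionSum Ψ P :=
  Finset.sum_sub_distrib _ _

theorem partitionSum_const_mul (c : ℝ) (Ξ : ℝ → ℝ → ℝ) (P : Finset ℝ) :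
    partitionSum (fun u v => c * Ξ u v) P = c * partitionSum Ξ P :=
  (Finset.mul_sum _ _ _).symm

/-! ### Refinement Riemann–Stieltjes limits -/

section RRS

variable {E : Type*} [NormedAddCommGroup E] {T : ℝ}

theorem IsRRSLimit.sub {Ξ Ψ : ℝ → ℝ → E} {K L : E} (hΞ : IsRRSLimit T Ξ K)
    (hΨ : IsRRSLimit T Ψ L) : IsRRSLimit T (fun u v => Ξ u v - Ψ u v) (K - L) := by
  intro ε hε
  obtain ⟨P₁, h₁, h₁'⟩ := hΞ (ε / 2) (half_pos hε)
  obtain ⟨P₂, h₂, h₂'⟩ := hΨ (ε / 2) (half_pos hε)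
  refine ⟨P₁ ∪ P₂, h₁.union h₂, fun P hP hle => ?_⟩
  have e₁ := h₁' P hP (Finset.union_subset_left hle)
  have e₂ := h₂' P hP (Finset.union_subset_right hle)
  rw [partitionSum_sub]
  calc ‖partitionSum Ξ P - partitionSum Ψ P - (K - L)‖
      = ‖(partitionSum Ξ P - K) - (partitionSum Ψ P - L)‖ := by congr 1; abel
    _ ≤ ‖partitionSum Ξ P - K‖ + ‖partitionSum Ψ P - L‖ := norm_sub_le _ _
    _ < ε := by linarith

theorem IsRRSLimit.unique {Ξ : ℝ → ℝ → E} {K L : E} (hK : IsRRSLimit T Ξ K)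
    (hL : IsRRSLimit T Ξ L) : K = L := by
  rw [← sub_eq_zero, ← norm_le_zero_iff]
  refine le_of_forall_pos_le_add fun ε hε => ?_
  obtain ⟨P, hP, h⟩ := hK.sub hL ε hε
  have := h P hP subset_rfl
  simp only [sub_self, partitionSum, Finset.sum_const_zero, zero_sub, norm_neg] at this
  linarith

theorem IsRRSLimit.rrsLimit_eq {Ξ : ℝ → ℝ → E} {K : E} (hK : IsRRSLimit T Ξ K) :
    rrsLimit T Ξ = K := by
  have h : ∃ K, IsRRSLimit T Ξ K := ⟨K, hK⟩
  rw [rrsLimit, dif_pos h]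
  exact h.choose_spec.unique hK

theorem isRRSLimit_telescope (hT : 0 ≤ T) (g : ℝ → E) :
    IsRRSLimit T (fun u v => g v - g u) (g T - g 0) := fun ε hε =>
  ⟨_, isPartition_insert_insert hT (A := ∅) (by simp), fun P hP _ => by
    rwa [partitionSum_telescope g hP, sub_self, norm_zero]⟩

/-- Refining partitions and enlarging finite index sets are the same limit: a partition without `c`
is a finite subset of `s`, and every finite subset of `s` lies in some partition. Here `c` is the
endpoint of `[0, T]` that starts (`c = T`) or ends (`c = 0`) no interval. -/
theorem isRRSLimit_of_eq_sum_erase (hT : 0 ≤ T) {s : Set ℝ} (hs : s ⊆ Set.Icc 0 T) (c : ℝ)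
    (hsc : s = Set.Icc 0 T \ {c}) {f : ℝ → E} (hf : Summable fun t : s => f t)
    {Ξ : ℝ → ℝ → E}
    (hΞ : ∀ P, IsPartition T P → partitionSum Ξ P = ∑ t ∈ P.erase c, f t) :
    IsRRSLimit T Ξ (∑' t : s, f t) := by
  classical
  intro ε hε
  obtain ⟨A, hA⟩ := (Metric.tendsto_atTop.1 hf.hasSum) ε hε
  refine ⟨insert 0 (insert T (A.map ⟨Subtype.val, Subtype.val_injective⟩)),
    isPartition_insert_insert hT ?_, fun P hP hle => ?_⟩
  · intro a ha
    obtain ⟨b, -, rfl⟩ := Finset.mem_map.1 ha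
    exact hs b.2
  · have hmem : ∀ t ∈ P.erase c, t ∈ s := fun t ht => by
      rw [hsc]
      exact ⟨hP.2.2 t (Finset.mem_of_mem_erase ht), Finset.ne_of_mem_erase ht⟩
    have := hA ((P.erase c).subtype (· ∈ s)) fun a ha => by
      have haP : (a : ℝ) ∈ P := hle (by simp [ha])
      have has : (a : ℝ) ∈ Set.Icc 0 T \ {c} := hsc ▸ a.2
      exact Finset.mem_subtype.2 (Finset.mem_erase.2 ⟨has.2, haP⟩)
    rw [Finset.sum_subtype_of_mem f hmem, dist_eq_norm] at this
    rwa [hΞ P hP]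

theorem isRRSLimit_left (hT : 0 ≤ T) {f : ℝ → E} (hf : Summable fun t : Set.Ico 0 T => f t) :
    IsRRSLimit T (fun u _ => f u) (∑' t : Set.Ico 0 T, f t) :=
  isRRSLimit_of_eq_sum_erase hT Set.Ico_subset_Icc_self T Set.Icc_sdiff_right.symm hf
    fun _ hP => partitionSum_left f hP

theorem isRRSLimit_right (hT : 0 ≤ T) {f : ℝ → E} (hf : Summable fun t : Set.Ioc 0 T => f t) :
    IsRRSLimit T (fun _ v => f v) (∑' t : Set.Ioc 0 T, f t) :=
  isRRSLimit_of_eq_sum_erase hT Set.Ioc_subset_Icc_self 0 Set.Icc_sdiff_left.symm hf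
    fun _ hP => partitionSum_right f hP

/-! ### Bounds over partitions and absolute summability. -/

theorem IsPartition.Icc_of_mem_intervals {P : Finset ℝ} (hP : IsPartition T P) {q : ℝ × ℝ}
    (hq : q ∈ partitionIntervals P) : 0 ≤ q.1 ∧ q.1 < q.2 ∧ q.2 ≤ T :=
  have h := mem_partitionIntervals.1 hq
  ⟨(hP.2.2 _ h.1.1).1, h.2.1, (hP.2.2 _ h.1.2).2⟩

theorem IsPartition.partitionSum_le {P : Finset ℝ} (hP : IsPartition T P) {Ξ Ψ : ℝ → ℝ → ℝ}
    (h : ∀ u v, 0 ≤ u → u < v → v ≤ T → Ξ u v ≤ Ψ u v) : partitionSum Ξ P ≤ partitionSum Ψ P :=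
  Finset.sum_le_sum fun q hq =>
    have hq' := hP.Icc_of_mem_intervals hq
    h q.1 q.2 hq'.1 hq'.2.1 hq'.2.2

theorem summable_norm_of_sum_erase_le (hT : 0 ≤ T) {s : Set ℝ} (c : ℝ)
    (hsc : s = Set.Icc 0 T \ {c}) {f : ℝ → E} {M : ℝ}
    (h : ∀ P, IsPartition T P → ∑ t ∈ P.erase c, ‖f t‖ ≤ M) :
    Summable fun t : s => ‖f t‖ := by
  classical
  refine summable_of_sum_le (c := M) (fun _ => norm_nonneg _) fun A => ?_
  set B : Finset ℝ := A.map ⟨Subtype.val, Subtype.val_injective⟩ with hB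
  have hBs : ∀ t ∈ B, t ∈ Set.Icc 0 T \ {c} := fun t ht => by
    obtain ⟨b, -, rfl⟩ := Finset.mem_map.1 ht
    exact hsc ▸ b.2
  have hsum : ∑ t ∈ A, ‖f t‖ = ∑ t ∈ B, ‖f t‖ := by rw [hB, Finset.sum_map]; rfl
  rw [hsum]
  refine le_trans ?_ (h _ (isPartition_insert_insert hT fun t ht => (hBs t ht).1))
  refine Finset.sum_le_sum_of_subset_of_nonneg (fun t ht => ?_) fun _ _ _ => norm_nonneg _
  exact Finset.mem_erase.2 ⟨(hBs t ht).2, by simp [ht]⟩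

theorem summable_norm_left (hT : 0 ≤ T) {f : ℝ → E} {w : ℝ → ℝ}
    (h : ∀ u v, 0 ≤ u → u < v → v ≤ T → ‖f u‖ ≤ w v - w u) :
    Summable fun t : Set.Ico 0 T => ‖f t‖ :=
  summable_norm_of_sum_erase_le hT (M := w T - w 0) T Set.Icc_sdiff_right.symm fun P hP => by
    rw [← partitionSum_left (fun t => ‖f t‖) hP, ← partitionSum_telescope w hP]
    exact hP.partitionSum_le h

theorem summable_norm_right (hT : 0 ≤ T) {f : ℝ → E} {w : ℝ → ℝ}
    (h : ∀ u v, 0 ≤ u → u < v → v ≤ T → ‖f v‖ ≤ w v - w u) :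
    Summable fun t : Set.Ioc 0 T => ‖f t‖ :=
  summable_norm_of_sum_erase_le hT (M := w T - w 0) 0 Set.Icc_sdiff_left.symm fun P hP => by
    rw [← partitionSum_right (fun t => ‖f t‖) hP, ← partitionSum_telescope w hP]
    exact hP.partitionSum_le h

/-! ### Sums controlled by a superlinear power of a monotone function. -/

theorem Real.rpow_le_rpow_sub_one_mul {x M θ : ℝ} (hx : 0 ≤ x) (hxM : x ≤ M) (hθ : 1 < θ) :
    x ^ θ ≤ M ^ (θ - 1) * x := by
  rcases hx.eq_or_lt with rfl | hx
  · simp [Real.zero_rpow (by linarith : θ ≠ 0)]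
  · calc x ^ θ = x ^ (θ - 1) * x := by
          rw [← Real.rpow_add_one hx.ne']; simp
      _ ≤ M ^ (θ - 1) * x := by gcongr

/-- A monotone function oscillates little on the intervals avoiding a suitable finite set. -/
theorem Monotone.exists_finset_sub_le {w : ℝ → ℝ} (hw : Monotone w) (T : ℝ) {η : ℝ} (hη : 0 < η) :
    ∃ A : Finset ℝ, ∀ u v, 0 ≤ u → u < v → v ≤ T → (∀ a ∈ A, a < u ∨ v < a) → w v - w u ≤ η := by
  classical
  obtain ⟨N, hN⟩ := exists_nat_gt ((w T - w 0) / η)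
  -- The points where `w` crosses the levels `w 0 + k * η`. An increase of more than `η` over `[u,
  -- v]` passes strictly over a level, which puts its crossing point in `[u, v]`. For that level the
  -- set is nonempty and bounded above, so junk values of `sSup` are harmless.
  refine ⟨(Finset.range (N + 1)).image fun k : ℕ => sSup {s | w s ≤ w 0 + k * η}, ?_⟩
  intro u v hu huv hvT hA
  by_contra! hlt
  have hwu : 0 ≤ w u - w 0 := sub_nonneg.2 (hw hu)
  set k := ⌊(w u - w 0) / η⌋₊ + 1 with hk
  have hku : w u < w 0 + k * η := by
    have := Nat.lt_floor_add_one ((w u - w 0) / η)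
    rw [div_lt_iff₀ hη] at this
    push_cast [hk]
    linarith
  have hkv : w 0 + k * η < w v := by
    have := Nat.floor_le (div_nonneg hwu hη.le)
    rw [le_div_iff₀ hη] at this
    push_cast [hk]
    linarith
  have hkN : k < N + 1 := by
    have h1 : (k : ℝ) * η < w T - w 0 := by linarith [hw hvT]
    rw [← lt_div_iff₀ hη] at h1
    have : (k : ℝ) < N := h1.trans hN
    exact (Nat.cast_lt.1 this).trans (Nat.lt_succ_self _)
  have hub : ∀ s ∈ {s | w s ≤ w 0 + k * η}, s ≤ v := fun s hs => by
    by_contra! h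
    exact absurd ((hw h.le).trans hs) (not_le.2 hkv)
  have hle : sSup {s | w s ≤ w 0 + k * η} ≤ v := csSup_le ⟨u, hku.le⟩ hub
  have hge : u ≤ sSup {s | w s ≤ w 0 + k * η} := le_csSup ⟨v, hub⟩ hku.le
  rcases hA _ (Finset.mem_image_of_mem _ (Finset.mem_range.2 hkN)) with h | h <;> linarith

theorem sum_ite_mem_le {A P : Finset ℝ} {ε : ℝ} (hε : 0 ≤ ε) :
    ∑ t ∈ P, (if t ∈ A then ε else 0) ≤ A.card * ε := by
  rw [← Finset.sum_filter, Finset.sum_const, nsmul_eq_mul]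
  gcongr
  exact fun t ht => (Finset.mem_filter.1 ht).2

/-- The Riemann sums of a function which vanishes at coinciding endpoints, and which is
dominated by a superlinear power of a monotone function, converge to zero. -/
theorem isRRSLimit_zero_of_control (hT : 0 ≤ T) {D : ℝ → ℝ → E} {w : ℝ → ℝ} (hw : Monotone w)
    {K θ : ℝ} (hK : 0 ≤ K) (hθ : 1 < θ)
    (hD : ∀ u v, 0 ≤ u → u < v → v ≤ T → ‖D u v‖ ≤ K * (w v - w u) ^ θ)
    (hr : ∀ u ∈ Set.Ico 0 T, Tendsto (D u) (𝓝[>] u) (𝓝 0))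
    (hl : ∀ v ∈ Set.Ioc 0 T, Tendsto (fun u => D u v) (𝓝[<] v) (𝓝 0)) :
    IsRRSLimit T D 0 := by
  classical
  intro ε hε
  obtain ⟨η, hη, hηε⟩ : ∃ η > 0, K * η ^ (θ - 1) * (w T - w 0) < ε / 2 := by
    have hc : Tendsto (fun η : ℝ => K * η ^ (θ - 1) * (w T - w 0)) (𝓝[>] 0) (𝓝 0) := by
      have : ContinuousAt (fun η : ℝ => K * η ^ (θ - 1) * (w T - w 0)) 0 :=
        ((Real.continuousAt_rpow_const _ _ (Or.inr (by linarith))).const_mul K).mul_const _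
      have h := this.tendsto
      rw [Real.zero_rpow (by linarith), mul_zero, zero_mul] at h
      exact h.mono_left nhdsWithin_le_nhds
    obtain ⟨η, h1, h2⟩ := ((hc.eventually (gt_mem_nhds (half_pos hε))).and
      self_mem_nhdsWithin).exists
    exact ⟨η, h2, h1⟩
  obtain ⟨A, hA⟩ := hw.exists_finset_sub_le T hη
  set B : Finset ℝ := insert 0 (insert T (A.filter (· ∈ Set.Icc 0 T))) with hB
  -- Each point of `B` starts at most one interval and ends at most one, so the intervals touching
  -- `B` cost at most `2 * B.card * δ ≤ ε / 4`.
  set δ : ℝ := ε / (8 * (B.card + 1)) with hδ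
  have hδ0 : 0 < δ := by positivity
  have hBδ : B.card * δ ≤ ε / 8 := by
    rw [hδ, mul_div_assoc', div_le_div_iff₀ (by positivity) (by norm_num)]
    nlinarith
  -- Once `r a` is a partition point, the interval starting at `a` must end by `r a`. The default
  -- `0` only adds a harmless partition point.
  have hr' : ∀ a, ∃ r ∈ Set.Icc 0 T, a ∈ Set.Ico 0 T → a < r ∧ ∀ v ∈ Set.Ioc a r, ‖D a v‖ ≤ δ := by
    intro a
    by_cases ha : a ∈ Set.Ico 0 T
    · have h1 : ∀ᶠ v in 𝓝[>] a, ‖D a v‖ < δ := (hr a ha).norm.eventually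
        (gt_mem_nhds (by simpa using hδ0))
      obtain ⟨r, hr1, hr2⟩ := mem_nhdsGT_iff_exists_Ioc_subset.1 h1
      have h2 : a < min r T := lt_min hr1 ha.2
      exact ⟨min r T, ⟨ha.1.trans h2.le, min_le_right _ _⟩,
        fun _ => ⟨h2, fun v hv => (hr2 ⟨hv.1, hv.2.trans (min_le_left _ _)⟩).le⟩⟩
    · exact ⟨0, ⟨le_rfl, hT⟩, fun h => absurd h ha⟩
  have hl' : ∀ a, ∃ r ∈ Set.Icc 0 T, a ∈ Set.Ioc 0 T → r < a ∧ ∀ v ∈ Set.Ico r a, ‖D v a‖ ≤ δ := by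
    intro a
    by_cases ha : a ∈ Set.Ioc 0 T
    · have h1 : ∀ᶠ v in 𝓝[<] a, ‖D v a‖ < δ := (hl a ha).norm.eventually
        (gt_mem_nhds (by simpa using hδ0))
      obtain ⟨r, hr1, hr2⟩ := mem_nhdsLT_iff_exists_Ico_subset.1 h1
      have h2 : max r 0 < a := max_lt hr1 ha.1
      exact ⟨max r 0, ⟨le_max_right _ _, h2.le.trans ha.2⟩,
        fun _ => ⟨h2, fun v hv => (hr2 ⟨(le_max_left _ _).trans hv.1, hv.2⟩).le⟩⟩
    · exact ⟨0, ⟨le_rfl, hT⟩, fun h => absurd h ha⟩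
  choose r hrT hr' using hr'
  choose l hlT hl' using hl'
  have hBp : IsPartition T B :=
    isPartition_insert_insert hT fun a ha => (Finset.mem_filter.1 ha).2
  refine ⟨B ∪ (B.image r ∪ B.image l), ?_, fun P hP hle => ?_⟩
  · refine ⟨Finset.mem_union_left _ hBp.1, Finset.mem_union_left _ hBp.2.1, fun t ht => ?_⟩
    simp only [Finset.mem_union, Finset.mem_image] at ht
    rcases ht with ht | ⟨a, -, rfl⟩ | ⟨a, -, rfl⟩
    exacts [hBp.2.2 t ht, hrT a, hlT a]
  have hBP : B ⊆ P := Finset.union_subset_left hle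
  have hrP : ∀ a ∈ B, r a ∈ P := fun a ha => hle
    (Finset.mem_union_right _ (Finset.mem_union_left _ (Finset.mem_image_of_mem _ ha)))
  have hlP : ∀ a ∈ B, l a ∈ P := fun a ha => hle
    (Finset.mem_union_right _ (Finset.mem_union_right _ (Finset.mem_image_of_mem _ ha)))
  have key : ∀ q ∈ partitionIntervals P, ‖D q.1 q.2‖ ≤
      K * η ^ (θ - 1) * (w q.2 - w q.1) + (if q.1 ∈ B then δ else 0)
        + (if q.2 ∈ B then δ else 0) := by
    rintro ⟨u, v⟩ hq
    obtain ⟨hu, huv, hv⟩ := hP.Icc_of_mem_intervals hq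
    have hgap := (mem_partitionIntervals.1 hq).2.2
    simp only at hu huv hv hgap ⊢
    have hwuv : 0 ≤ w v - w u := sub_nonneg.2 (hw huv.le)
    have hmain : 0 ≤ K * η ^ (θ - 1) * (w v - w u) := by positivity
    by_cases huB : u ∈ B
    · obtain ⟨h1, h2⟩ := hr' u ⟨hu, huv.trans_le hv⟩
      have hvr : v ≤ r u := not_lt.1 fun h => hgap _ (hrP u huB) ⟨h1, h⟩
      have h3 := h2 v ⟨huv, hvr⟩
      rw [if_pos huB]
      split_ifs <;> linarith
    by_cases hvB : v ∈ B
    · obtain ⟨h1, h2⟩ := hl' v ⟨hu.trans_lt huv, hv⟩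
      have hvr : l v ≤ u := not_lt.1 fun h => hgap _ (hlP v hvB) ⟨h, h1⟩
      have h3 := h2 u ⟨hvr, huv⟩
      rw [if_pos hvB]
      split_ifs
      linarith
    · rw [if_neg huB, if_neg hvB, add_zero, add_zero]
      have hη' : w v - w u ≤ η := by
        refine hA u v hu huv hv fun a ha => ?_
        by_contra! h
        have haB : a ∈ B := by
          simp only [hB, Finset.mem_insert, Finset.mem_filter]
          exact Or.inr (Or.inr ⟨ha, hu.trans h.1, h.2.trans hv⟩)
        -- Neither endpoint is in `B`, so a point of `B` in `[u, v]` would lie strictly between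
        -- consecutive partition points.
        refine hgap a (hBP haB) ⟨lt_of_le_of_ne h.1 ?_, lt_of_le_of_ne h.2 ?_⟩
        · rintro rfl; exact huB haB
        · rintro rfl; exact hvB haB
      calc ‖D u v‖ ≤ K * (w v - w u) ^ θ := hD u v hu huv hv
        _ ≤ K * (η ^ (θ - 1) * (w v - w u)) := by
          gcongr; exact Real.rpow_le_rpow_sub_one_mul hwuv hη' hθ
        _ = _ := by ring
  rw [sub_zero]
  calc ‖partitionSum D P‖ ≤ ∑ q ∈ partitionIntervals P, ‖D q.1 q.2‖ := norm_sum_le _ _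
    _ ≤ partitionSum (fun u v => K * η ^ (θ - 1) * (w v - w u) + (if u ∈ B then δ else 0)
        + (if v ∈ B then δ else 0)) P := Finset.sum_le_sum key
    _ = K * η ^ (θ - 1) * (w T - w 0) + ∑ t ∈ P.erase T, (if t ∈ B then δ else 0)
        + ∑ t ∈ P.erase 0, (if t ∈ B then δ else 0) := by
      rw [partitionSum_add, partitionSum_add, partitionSum_const_mul, partitionSum_telescope w hP,
        partitionSum_left (fun u => if u ∈ B then δ else 0) hP,
        partitionSum_right (fun u => if u ∈ B then δ else 0) hP]
    _ < ε := by
      have h1 := sum_ite_mem_le (A := B) (P := P.erase T) hδ0.le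
      have h2 := sum_ite_mem_le (A := B) (P := P.erase 0) hδ0.le
      linarith

end RRS

/-! ### Paths of finite `p`-variation -/

section Path

variable {V : Type*} [NormedAddCommGroup V] {p T : ℝ} {X : ℝ → V}

/-- The increments of a path of finite `p`-variation are controlled by a monotone function. -/
theorem exists_control_of_pVariation_lt_top (hp : 1 ≤ p) (hX : pVariation p T X < ∞) :
    ∃ w : ℝ → ℝ, Monotone w ∧ ∀ u v, 0 ≤ u → u ≤ v → v ≤ T → ‖X v - X u‖ ^ p ≤ w v - w u := by
  have hp0 : 0 < p := by linarith
  set W : ℝ → ℝ≥0∞ := fun s => ⨆ (P : Finset ℝ) (_ : IsPartition s P),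
    partitionSum (fun u v => ‖X v - X u‖ₑ ^ p) P with hW
  have hWT : W T < ∞ := by
    have : (W T) ^ (1 / p) < ∞ := hX
    exact (ENNReal.rpow_lt_top_iff_of_pos (by positivity)).1 this
  -- Appending `[u, v]` to any partition of `[0, u]` gives a partition of `[0, v]`.
  have step : ∀ u v, 0 ≤ u → u ≤ v → ‖X v - X u‖ₑ ^ p + W u ≤ W v := by
    intro u v hu huv
    rcases huv.eq_or_lt with rfl | huv
    · simp [ENNReal.zero_rpow_of_pos hp0]
    rw [hW]
    simp only
    rw [ENNReal.add_biSup' ⟨_, isPartition_insert_insert hu (A := ∅) (by simp)⟩]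
    refine iSup₂_le fun P hP => ?_
    rw [← partitionSum_insert (fun u v => ‖X v - X u‖ₑ ^ p) hP huv]
    exact le_iSup₂_of_le _ (hP.insert_right huv.le) le_rfl
  have hWmono : ∀ u v, 0 ≤ u → u ≤ v → W u ≤ W v := fun u v hu huv =>
    le_add_self.trans (step u v hu huv)
  have hfin : ∀ v, 0 ≤ v → v ≤ T → W v ≠ ∞ := fun v h0 hv => ((hWmono v T h0 hv).trans_lt hWT).ne
  by_cases hT : 0 ≤ T
  swap
  · exact ⟨fun _ => 0, monotone_const, fun u v h1 h2 h3 => absurd (h1.trans (h2.trans h3)) hT⟩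
  -- Clamping to `[0, T]` keeps `W` finite and makes the control monotone on all of `ℝ`.
  refine ⟨fun s => (W (max 0 (min T s))).toReal, fun s t hst => ?_, fun u v hu huv hv => ?_⟩
  · refine ENNReal.toReal_mono (hfin _ (le_max_left _ _) (max_le hT (min_le_left _ _))) ?_
    exact hWmono _ _ (le_max_left _ _) (by gcongr)
  · have h := step u v hu huv
    have e1 : max 0 (min T u) = u := by rw [min_eq_right (huv.trans hv), max_eq_right hu]
    have e2 : max 0 (min T v) = v := by rw [min_eq_right hv, max_eq_right (hu.trans huv)]
    simp only [e1, e2]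
    have h' := ENNReal.toReal_mono (hfin v (hu.trans huv) hv) h
    rw [ENNReal.toReal_add (ne_top_of_le_ne_top (hfin v (hu.trans huv) hv) (le_self_add.trans h))
      (hfin u hu (huv.trans hv)), ← ENNReal.toReal_rpow, toReal_enorm] at h'
    linarith

variable {w : ℝ → ℝ}

/-- Cauchy criterion: `w` converges along `l`, so its increments there are small, and they dominate
those of `X`. A general filter serves left and right limits alike. -/
theorem exists_tendsto_of_control [CompleteSpace V]
    (hX : ∀ u v, 0 ≤ u → u ≤ v → v ≤ T → ‖X v - X u‖ ^ p ≤ w v - w u)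
    (hp : 0 < p) {l : Filter ℝ} [l.NeBot]
    {c : ℝ} (hw : Tendsto w l (𝓝 c)) (hl : ∀ᶠ s in l, s ∈ Set.Icc 0 T) :
    ∃ y, Tendsto X l (𝓝 y) := by
  rw [← cauchy_map_iff_exists_tendsto, Metric.cauchy_iff]
  refine ⟨inferInstance, fun ε hε => ?_⟩
  have hε' : 0 < ε ^ p / 2 := by positivity
  refine ⟨X '' {s | s ∈ Set.Icc 0 T ∧ dist (w s) c < ε ^ p / 2},
    image_mem_map (hl.and (hw.eventually (Metric.ball_mem_nhds c hε'))), ?_⟩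
  have key : ∀ s t, s ∈ Set.Icc 0 T → t ∈ Set.Icc 0 T → s ≤ t → dist (w s) c < ε ^ p / 2 →
      dist (w t) c < ε ^ p / 2 → ‖X t - X s‖ < ε := by
    intro s t hs ht hst hsc htc
    rw [← Real.rpow_lt_rpow_iff (norm_nonneg _) hε.le hp]
    rw [Real.dist_eq, abs_lt] at hsc htc
    linarith [hX s t hs.1 hst ht.2]
  rintro _ ⟨s, ⟨hs, hsc⟩, rfl⟩ _ ⟨t, ⟨ht, htc⟩, rfl⟩
  rcases le_total s t with h | h
  · rw [dist_comm, dist_eq_norm]; exact key s t hs ht h hsc htc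
  · rw [dist_eq_norm]; exact key t s ht hs h htc hsc

theorem tendsto_leftLim_of_control [CompleteSpace V]
    (hX : ∀ u v, 0 ≤ u → u ≤ v → v ≤ T → ‖X v - X u‖ ^ p ≤ w v - w u)
    (hp : 0 < p) (hw : Monotone w) {t : ℝ}
    (ht : t ∈ Set.Ioc 0 T) : Tendsto X (𝓝[<] t) (𝓝 (Function.leftLim X t)) :=
  tendsto_leftLim_of_tendsto <| exists_tendsto_of_control hX hp (hw.tendsto_leftLim t) <| by
    filter_upwards [Ioo_mem_nhdsLT ht.1] with s hs using ⟨hs.1.le, hs.2.le.trans ht.2⟩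

theorem tendsto_rightLim_of_control [CompleteSpace V]
    (hX : ∀ u v, 0 ≤ u → u ≤ v → v ≤ T → ‖X v - X u‖ ^ p ≤ w v - w u)
    (hp : 0 < p) (hw : Monotone w) {t : ℝ}
    (ht : t ∈ Set.Ico 0 T) : Tendsto X (𝓝[>] t) (𝓝 (Function.rightLim X t)) :=
  tendsto_rightLim_of_tendsto <| exists_tendsto_of_control hX hp (hw.tendsto_rightLim t) <| by
    filter_upwards [Ioo_mem_nhdsGT ht.2] with s hs using ⟨ht.1.trans hs.1.le, hs.2.le⟩

/-- The increment bound on `[s, v]` passes to the limit `s ↑ v`. Any `u < v` is allowed, so that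
these bounds telescope over a partition. -/
theorem norm_leftJump_rpow_le [CompleteSpace V]
    (hX : ∀ u v, 0 ≤ u → u ≤ v → v ≤ T → ‖X v - X u‖ ^ p ≤ w v - w u)
    (hp : 0 < p) (hw : Monotone w) {u v : ℝ}
    (hu : 0 ≤ u) (huv : u < v) (hv : v ≤ T) :
    ‖X v - Function.leftLim X v‖ ^ p ≤ w v - w u := by
  have ht := tendsto_leftLim_of_control hX hp hw ⟨hu.trans_lt huv, hv⟩
  refine le_of_tendsto ((ht.const_sub (X v)).norm.rpow_const (Or.inr hp.le)) ?_
  filter_upwards [Ioo_mem_nhdsLT huv] with s hs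
  linarith [hX s v (hu.trans hs.1.le) hs.2.le hv, hw hs.1.le]

theorem norm_rightJump_rpow_le [CompleteSpace V]
    (hX : ∀ u v, 0 ≤ u → u ≤ v → v ≤ T → ‖X v - X u‖ ^ p ≤ w v - w u)
    (hp : 0 < p) (hw : Monotone w) {u v : ℝ}
    (hu : 0 ≤ u) (huv : u < v) (hv : v ≤ T) :
    ‖Function.rightLim X u - X u‖ ^ p ≤ w v - w u := by
  have ht := tendsto_rightLim_of_control hX hp hw ⟨hu, huv.trans_le hv⟩
  refine le_of_tendsto ((ht.sub_const (X u)).norm.rpow_const (Or.inr hp.le)) ?_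
  filter_upwards [Ioo_mem_nhdsGT huv] with s hs
  linarith [hX u s hu hs.1.le (hs.2.le.trans hv), hw hs.2.le]

end Path

/-! ### Taylor remainders -/

section Taylor

variable {V U : Type*} [NormedAddCommGroup V] [NormedSpace ℝ V]
  [NormedAddCommGroup U] [NormedSpace ℝ U] {n : ℕ} {F : V → U}

/-- The remainder in Taylor's formula of order `n` for `F y` at `x`. -/
noncomputable def taylorRemainder (n : ℕ) (F : V → U) (x y : V) : U :=
  F y - F x - taylorTerms n F x (y - x)

theorem taylorRemainder_self (n : ℕ) (F : V → U) (x : V) : taylorRemainder n F x x = 0 := by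
  rw [taylorRemainder, sub_self, sub_self, zero_sub, neg_eq_zero]
  refine Finset.sum_eq_zero fun k hk => ?_
  have : Nonempty (Fin k) := ⟨⟨0, (Finset.mem_Icc.1 hk).1⟩⟩
  rw [show (fun _ : Fin k => (0 : V)) = 0 from rfl, ContinuousMultilinearMap.map_zero, smul_zero]

/-- Joint continuity identifies the one-sided limits of remainders along `X` with the jump
corrections. -/
theorem continuous_taylorRemainder (hF : ContDiff ℝ n F) :
    Continuous fun z : V × V => taylorRemainder n F z.1 z.2 := by
  have hc := hF.continuous
  have hk : ∀ k ∈ Finset.Icc 1 n, Continuous fun z : V × V =>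
      (1 / (k.factorial : ℝ)) • iteratedFDeriv ℝ k F z.1 (fun _ => z.2 - z.1) := by
    intro k hk
    have h1 : Continuous (iteratedFDeriv ℝ k F) :=
      hF.continuous_iteratedFDeriv (by exact_mod_cast (Finset.mem_Icc.1 hk).2)
    have h2 : Continuous fun z : V × V => iteratedFDeriv ℝ k F z.1 := h1.comp continuous_fst
    have h3 : Continuous fun z : V × V => (fun _ : Fin k => z.2 - z.1) := by fun_prop
    exact (h2.eval h3).const_smul _
  have := continuous_finsetSum _ hk
  exact ((hc.comp continuous_snd).sub (hc.comp continuous_fst)).sub this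

/-- Integral form of the remainder, with `(1 - t) ^ n` and the inverse factorial both bounded by
one. -/
theorem exists_norm_taylorRemainder_le [CompleteSpace U] (hF : IsCb (n + 1) F) :
    ∃ C : ℝ, 0 ≤ C ∧ ∀ x y, ‖taylorRemainder n F x y‖ ≤ C * ‖y - x‖ ^ (n + 1) := by
  obtain ⟨C, hC⟩ := hF.2 (n + 1) le_rfl
  have hC0 : 0 ≤ C := (norm_nonneg _).trans (hC 0)
  refine ⟨C, hC0, fun x y => ?_⟩
  have h := map_add_eq_sum_add_integral_iteratedFDeriv (f := F) (x := x) (y := y - x) (n := n)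
    fun t _ => by exact_mod_cast hF.1.contDiffAt
  have hR : taylorRemainder n F x y = ((n.factorial : ℝ)⁻¹) • ∫ t in (0 : ℝ)..1,
      (1 - t) ^ n • iteratedFDeriv ℝ (n + 1) F (x + t • (y - x)) (fun _ => y - x) := by
    have hs : ∑ k ∈ Finset.range (n + 1),
        ((k.factorial : ℝ)⁻¹) • iteratedFDeriv ℝ k F x (fun _ => y - x)
          = F x + taylorTerms n F x (y - x) := by
      rw [Finset.range_eq_Ico, Finset.sum_eq_sum_Ico_succ_bot (Nat.succ_pos n), taylorTerms]
      simp only [one_div]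
      congr 1
      simp
    rw [hs, add_sub_cancel] at h
    rw [taylorRemainder, h]
    abel
  rw [hR, norm_smul]
  have hint : ‖∫ t in (0 : ℝ)..1, (1 - t) ^ n •
      iteratedFDeriv ℝ (n + 1) F (x + t • (y - x)) (fun _ => y - x)‖
        ≤ C * ‖y - x‖ ^ (n + 1) * |(1 : ℝ) - 0| := by
    refine intervalIntegral.norm_integral_le_of_norm_le_const fun t ht => ?_
    rw [Set.uIoc_of_le zero_le_one] at ht
    have h1 : ‖(1 - t) ^ n‖ ≤ 1 := by
      rw [norm_pow]
      refine pow_le_one₀ (norm_nonneg _) ?_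
      rw [Real.norm_eq_abs, abs_le]
      constructor <;> linarith [ht.1, ht.2]
    have h2 : ‖iteratedFDeriv ℝ (n + 1) F (x + t • (y - x)) (fun _ => y - x)‖
        ≤ C * ‖y - x‖ ^ (n + 1) := by
      refine (ContinuousMultilinearMap.le_opNorm _ _).trans ?_
      rw [Finset.prod_const, Finset.card_univ, Fintype.card_fin]
      gcongr
      exact hC _
    rw [norm_smul]
    exact (mul_le_mul h1 h2 (norm_nonneg _) zero_le_one).trans_eq (one_mul _)
  have hfac : ‖((n.factorial : ℝ)⁻¹)‖ ≤ 1 := by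
    rw [norm_inv, Real.norm_natCast]
    exact inv_le_one_of_one_le₀ (by exact_mod_cast n.factorial_pos)
  calc _ ≤ 1 * (C * ‖y - x‖ ^ (n + 1) * |(1 : ℝ) - 0|) :=
        mul_le_mul hfac hint (norm_nonneg _) zero_le_one
    _ = _ := by simp

end Taylor

/-! ### The change of variable formula -/

section ChangeOfVariable

variable {V U : Type*} [NormedAddCommGroup V] [NormedSpace ℝ V] [CompleteSpace V]
  [NormedAddCommGroup U] [NormedSpace ℝ U] [CompleteSpace U]
  {p T : ℝ} {n : ℕ} {X : ℝ → V} {F : V → U} {w : ℝ → ℝ}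

/-- The jump corrections of a path of finite `p`-variation are absolutely summable, and the
compensated Riemann sums converge to the increment of `F ∘ X` minus the jump corrections. -/
theorem summable_jumpCorrections_and_isRRSLimit (hT : 0 ≤ T) (hp : 0 < p) (hpn : p < n + 1)
    (hw : Monotone w)
    (hX : ∀ u v, 0 ≤ u → u ≤ v → v ≤ T → ‖X v - X u‖ ^ p ≤ w v - w u) (hF : IsCb (n + 1) F) :
    Summable (fun t : Set.Ioc 0 T => ‖leftJumpCorrection n F X t‖) ∧
    Summable (fun t : Set.Ico 0 T => ‖rightJumpCorrection n F X t‖) ∧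
    IsRRSLimit T (roughSummand n F X) (F (X T) - F (X 0)
      - ∑' t : Set.Ioc 0 T, leftJumpCorrection n F X t
      - ∑' t : Set.Ico 0 T, rightJumpCorrection n F X t) := by
  obtain ⟨C, hC0, hC⟩ := exists_norm_taylorRemainder_le hF
  set θ : ℝ := (n + 1) / p with hθ
  have hθ1 : 1 < θ := (one_lt_div hp).2 hpn
  have hbound : ∀ x y d, ‖y - x‖ ^ p ≤ d → ‖taylorRemainder n F x y‖ ≤ C * d ^ θ := by
    intro x y d hd
    refine (hC x y).trans (mul_le_mul_of_nonneg_left ?_ hC0)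
    calc ‖y - x‖ ^ (n + 1) = (‖y - x‖ ^ p) ^ θ := by
          rw [← Real.rpow_mul (norm_nonneg _), hθ, mul_div_cancel₀ _ hp.ne', ← Real.rpow_natCast]
          push_cast
          rfl
      _ ≤ d ^ θ := by gcongr
  have hleft : ∀ u v, 0 ≤ u → u < v → v ≤ T →
      ‖leftJumpCorrection n F X v‖ ≤ C * (w v - w u) ^ θ := fun u v hu huv hv =>
    hbound _ _ _ (norm_leftJump_rpow_le hX hp hw hu huv hv)
  have hright : ∀ u v, 0 ≤ u → u < v → v ≤ T →
      ‖rightJumpCorrection n F X u‖ ≤ C * (w v - w u) ^ θ := fun u v hu huv hv =>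
    hbound _ _ _ (norm_rightJump_rpow_le hX hp hw hu huv hv)
  set c := C * (w T - w 0) ^ (θ - 1) with hc
  have hlin : ∀ u v, 0 ≤ u → u < v → v ≤ T →
      C * (w v - w u) ^ θ ≤ c * w v - c * w u := fun u v hu huv hv => by
    rw [← mul_sub, hc, mul_assoc]
    refine mul_le_mul_of_nonneg_left (Real.rpow_le_rpow_sub_one_mul ?_ ?_ hθ1) hC0
    · exact sub_nonneg.2 (hw huv.le)
    · linarith [hw hu, hw hv]
  have hsl : Summable (fun t : Set.Ioc 0 T => ‖leftJumpCorrection n F X t‖) :=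
    summable_norm_right hT (w := fun s => c * w s) fun u v hu huv hv =>
      (hleft u v hu huv hv).trans (hlin u v hu huv hv)
  have hsr : Summable (fun t : Set.Ico 0 T => ‖rightJumpCorrection n F X t‖) :=
    summable_norm_left hT (w := fun s => c * w s) fun u v hu huv hv =>
      (hright u v hu huv hv).trans (hlin u v hu huv hv)
  refine ⟨hsl, hsr, ?_⟩
  have hcont := continuous_taylorRemainder (n := n) (F := F)
    (hF.1.of_le (by exact_mod_cast Nat.le_succ n))
  have hθ0 : Tendsto (fun x : ℝ => C * x ^ θ) (𝓝 0) (𝓝 0) := by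
    have : ContinuousAt (fun x : ℝ => C * x ^ θ) 0 :=
      (Real.continuousAt_rpow_const _ _ (Or.inr (by linarith))).const_mul C
    simpa [ContinuousAt, Real.zero_rpow (by linarith : θ ≠ 0)] using this
  have hD : IsRRSLimit T (fun u v => taylorRemainder n F (X u) (X v)
      - leftJumpCorrection n F X v - rightJumpCorrection n F X u) 0 := by
    refine isRRSLimit_zero_of_control hT hw (K := C + C + C) (by positivity) hθ1 ?_ ?_ ?_
    · intro u v hu huv hv
      have h1 := hbound _ _ _ (hX u v hu huv.le hv)
      have h2 := hleft u v hu huv hv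
      have h3 := hright u v hu huv hv
      calc _ ≤ ‖taylorRemainder n F (X u) (X v)‖ + ‖leftJumpCorrection n F X v‖
            + ‖rightJumpCorrection n F X u‖ :=
            (norm_sub_le _ _).trans (add_le_add_left (norm_sub_le _ _) _)
        _ ≤ _ := by linarith
    · intro u hu
      have h1 : Tendsto (fun v => taylorRemainder n F (X u) (X v)) (𝓝[>] u)
          (𝓝 (rightJumpCorrection n F X u)) :=
        (hcont.tendsto (X u, Function.rightLim X u)).comp
          (tendsto_const_nhds.prodMk_nhds (tendsto_rightLim_of_control hX hp hw hu))
      have h2 : Tendsto (fun v => leftJumpCorrection n F X v) (𝓝[>] u) (𝓝 0) := by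
        -- Comparison with `w u` would not suffice, since `w` may jump at `u`; the left jump at `v >
        -- u` is bounded by the increment of `w` from `u+` to `v`, which tends to zero.
        have h3 : Tendsto (fun v => C * (w v - Function.rightLim w u) ^ θ) (𝓝[>] u) (𝓝 0) :=
          hθ0.comp (by simpa using (hw.tendsto_rightLim u).sub_const (Function.rightLim w u))
        refine squeeze_zero_norm' ?_ h3
        filter_upwards [Ioc_mem_nhdsGT hu.2] with v hv
        refine hbound _ _ _ ?_
        refine ge_of_tendsto ((hw.tendsto_rightLim u).const_sub (w v)) ?_
        filter_upwards [Ioo_mem_nhdsGT hv.1] with s hs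
        exact norm_leftJump_rpow_le hX hp hw (hu.1.trans hs.1.le) hs.2 hv.2
      simpa using (h1.sub h2).sub_const (rightJumpCorrection n F X u)
    · intro v hv
      have h1 : Tendsto (fun u => taylorRemainder n F (X u) (X v)) (𝓝[<] v)
          (𝓝 (leftJumpCorrection n F X v)) :=
        (hcont.tendsto (Function.leftLim X v, X v)).comp
          ((tendsto_leftLim_of_control hX hp hw hv).prodMk_nhds tendsto_const_nhds)
      have h2 : Tendsto (fun u => rightJumpCorrection n F X u) (𝓝[<] v) (𝓝 0) := by
        have h3 : Tendsto (fun u => C * (Function.leftLim w v - w u) ^ θ) (𝓝[<] v) (𝓝 0) :=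
          hθ0.comp (by simpa using (hw.tendsto_leftLim v).const_sub (Function.leftLim w v))
        refine squeeze_zero_norm' ?_ h3
        filter_upwards [Ico_mem_nhdsLT hv.1] with u hu
        refine hbound _ _ _ ?_
        refine ge_of_tendsto ((hw.tendsto_leftLim v).sub_const (w u)) ?_
        filter_upwards [Ioo_mem_nhdsLT hu.2] with s hs
        exact norm_rightJump_rpow_le hX hp hw hu.1 hs.1 (hs.2.le.trans hv.2)
      simpa using (h1.sub_const (leftJumpCorrection n F X v)).sub h2
  have hlim := (((isRRSLimit_telescope hT fun t => F (X t)).sub hD).sub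
    (isRRSLimit_right hT hsl.of_norm)).sub (isRRSLimit_left hT hsr.of_norm)
  rw [sub_zero] at hlim
  convert hlim using 3 with u v
  rw [roughSummand, taylorRemainder]
  abel

end ChangeOfVariable

theorem theorem3p1 {V U : Type*}
    [NormedAddCommGroup V] [NormedSpace ℝ V] [CompleteSpace V]
    [NormedAddCommGroup U] [NormedSpace ℝ U] [CompleteSpace U]
    (p : ℝ) (hp : 1 ≤ p) (T : ℝ) (hT : 0 ≤ T)
    (X : ℝ → V) (hX : pVariation p T X < ∞)
    (F : V → U) (hF : IsCb (⌊p⌋₊ + 1) F) :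
    -- the one-sided limits, the integral and the two series exist
    ((∀ t ∈ Set.Ioc 0 T, Tendsto X (𝓝[<] t) (𝓝 (Function.leftLim X t))) ∧
      (∀ t ∈ Set.Ico 0 T, Tendsto X (𝓝[>] t) (𝓝 (Function.rightLim X t))) ∧
      IsRRSLimit T (roughSummand ⌊p⌋₊ F X) (reducedRoughIntegral p T F X) ∧
      (∀ K, IsRRSLimit T (roughSummand ⌊p⌋₊ F X) K → K = reducedRoughIntegral p T F X) ∧
      Summable (fun t : Set.Ioc 0 T => ‖leftJumpCorrection ⌊p⌋₊ F X t‖) ∧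
      Summable (fun t : Set.Ico 0 T => ‖rightJumpCorrection ⌊p⌋₊ F X t‖)) ∧
    -- the general formula
    (F (X T) - F (X 0) = reducedRoughIntegral p T F X
      + ∑' t : Set.Ioc 0 T, leftJumpCorrection ⌊p⌋₊ F X t
      + ∑' t : Set.Ico 0 T, rightJumpCorrection ⌊p⌋₊ F X t) ∧
    -- right-continuous (càdlàg) paths
    ((∀ t ∈ Set.Ico 0 T, ContinuousWithinAt X (Set.Ioi t) t) →
      F (X T) - F (X 0) = reducedRoughIntegral p T F X
        + ∑' t : Set.Ioc 0 T, leftJumpCorrection ⌊p⌋₊ F X t) ∧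
    -- continuous paths
    (ContinuousOn X (Set.Icc 0 T) →
      F (X T) - F (X 0) = reducedRoughIntegral p T F X) := by
  have hp0 : 0 < p := by linarith
  obtain ⟨w, hw, hXw⟩ := exists_control_of_pVariation_lt_top hp hX
  obtain ⟨hsl, hsr, hlim⟩ :=
    summable_jumpCorrections_and_isRRSLimit hT hp0 (Nat.lt_floor_add_one p) hw hXw hF
  have hint : reducedRoughIntegral p T F X = _ := hlim.rrsLimit_eq
  have hformula : F (X T) - F (X 0) = reducedRoughIntegral p T F X
      + ∑' t : Set.Ioc 0 T, leftJumpCorrection ⌊p⌋₊ F X t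
      + ∑' t : Set.Ico 0 T, rightJumpCorrection ⌊p⌋₊ F X t := by
    rw [hint]
    abel
  have hright : (∀ t ∈ Set.Ico 0 T, ContinuousWithinAt X (Set.Ioi t) t) →
      F (X T) - F (X 0) = reducedRoughIntegral p T F X
        + ∑' t : Set.Ioc 0 T, leftJumpCorrection ⌊p⌋₊ F X t := by
    intro hc
    have h0 : ∑' t : Set.Ico 0 T, rightJumpCorrection ⌊p⌋₊ F X t = 0 := by
      refine (tsum_congr fun t => ?_).trans tsum_zero
      -- A jump correction is by definition a Taylor remainder, here with both points equal.
      change taylorRemainder _ F (X t) (Function.rightLim X t) = 0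
      rw [rightLim_eq_of_tendsto (hc t t.2).tendsto, taylorRemainder_self]
    rw [hformula, h0, add_zero]
  refine ⟨⟨fun t ht => tendsto_leftLim_of_control hXw hp0 hw ht,
    fun t ht => tendsto_rightLim_of_control hXw hp0 hw ht, hint ▸ hlim,
    fun K hK => hK.rrsLimit_eq.symm, hsl, hsr⟩, hformula, hright, fun hc => ?_⟩
  have h0 : ∑' t : Set.Ioc 0 T, leftJumpCorrection ⌊p⌋₊ F X t = 0 := by
    refine (tsum_congr fun t => ?_).trans tsum_zero
    have hct : Tendsto X (𝓝[<] (t : ℝ)) (𝓝 (X t)) :=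
      (hc t (Set.Ioc_subset_Icc_self t.2)).mono_left
        (nhdsWithin_le_of_mem (Icc_mem_nhdsLT_of_mem t.2))
    change taylorRemainder _ F (Function.leftLim X t) (X t) = 0
    rw [leftLim_eq_of_tendsto hct, taylorRemainder_self]
  rw [hright fun t ht => (hc t (Set.Ico_subset_Icc_self ht)).mono_left
    (nhdsWithin_le_of_mem (Icc_mem_nhdsGT_of_mem ht)), h0, add_zero]
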